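/- Theorem (Compressed-SSC under deterministic noise). \label{thm_main_noisy} Setting. Let $\mathcal U^{(1)},\dots,\mathcal U^{(k)}\subseteq\mathbb R^d$ be linear subspaces, and let $\mathbf X=\mathbf Y+\mathbf Z\in\mathbb R^{d\times N}$, where each column $y_i$ of $\mathbf Y$ has unit Euclidean norm and lies in the subspace $\mathcal U^{(\ell)}$ of its cluster $\ell$, and the noise columns $z_i$ are arbitrary with $\max_i\|z_i\|_2\le\eta$. Write $\mathbf X^{(\ell)}$, $\mathbf Y^{(\ell)}$ for the columns of the $\ell$-th cluster, and let the subscript $-i$ mean that the $i$-th column is left out. Let $\lambda>0$. Geometric quantities. For a column $x_i$ of the $\ell$-th cluster, let $\nu(x_i)$ be the unique maximizer of $\langle x_i,\nu\rangle-\frac{\lambda}{2}\nu^\top\nu$ over $\nu\in\mathbb R^d$ subject to $\|(\mathbf X^{(\ell)}_{-i})^\top\nu\|_\infty\le 1$, and let $v(x_i)=\mathcal P_{\mathcal U^{(\ell)}}\nu(x_i)/\|\mathcal P_{\mathcal U^{(\ell)}}\nu(x_i)\|_2$. The subspace incoherence is $$\mu_\ell=\max\{|\langle v(x_i),x_j\rangle|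 : x_i \text{ in cluster } \ell,\ x_j\text{ not in cluster }\ell\}$$ (with value $0$ if there is only one cluster). The inradius is $\rho_\ell=\min_i r(\mathcal Q(\mathbf Y^{(\ell)}_{-i}))$, over the points $i$ of cluster $\ell$, where $\mathcal Q(\mathbf A)$ is the convex hull of the columns of $\mathbf A$ and their negatives, and $r(\cdot)$ is the radius of the largest ball of the subspace $\mathcal U^{(\ell)}$ contained in that set. Put $\rho=\min_\ell\rho_\ell$ and $\Delta=\min_\ell(\rho_\ell-\mu_\ell)$. Compression. A matrix $\mathbf\Psi\in\mathbb R^{p\times d}$ is $\epsilon$-well-behaved if $|\langle x,y\rangle-\langle\mathbf\Psi x,\mathbf\Psi y\rangle|\le\epsilon\,\frac{\|x\|^2+\|y\|^2}{2}$ for all $\ell,\ell'$ and all $x,y\in\mathcal U^{(\ell)}\cup\mathcal U^{(\ell')}$, and $(1-\epsilon)\|x\|_2^2\le\|\mathbf\Psi x\|_2^2\le(1+\epsilon)\|x\|_2^2$ for all $x\in\{x_1,z_1,\dots,x_N,z_N\}$. The compressed data are $\widetilde{\mathbf X}'=\widetilde{\mathbf Y}'+\widetilde{\mathbf Z}$,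 where $\widetilde{\mathbf Y}'$ has the columns $\mathbf\Psi y_i/\|\mathbf\Psi y_i\|_2$ and $\widetilde{\mathbf Z}=\mathbf\Psi\mathbf Z$. Lasso SSC on $\widetilde{\mathbf X}'$ returns, for each $i$, a minimizer $c_i\in\mathbb R^N$ of $\|\tilde x'_i-\widetilde{\mathbf X}'c\|_2^2+2\lambda\|c\|_1$ subject to $c_{ii}=0$. It has the subspace detection property if such minimizers exist and, for every choice of them and every $i$, $c_i\ne 0$, and $c_{ij}\neq0$ only if $i$ and $j$ belong to the same cluster. Claim. There is a universal constant $c>0$ (independent of $d,p,N,k$, the subspaces, the data, $\mathbf\Psi$, $\epsilon$, $\eta$, $\lambda$) such that, if $\mu_\ell<\rho_\ell$ for all $\ell$, if $\mathbf\Psi$ is $\epsilon$-well-behaved, if $$\frac{24\eta}{\Delta}<\lambda<\rho(1-\epsilon)-6\eta,$$ and if $\max(\epsilon,\eta)\le c\,\Delta^2\lambda^{3/2}$, then Lasso SSC with parameter $\lambda$ on $\widetilde{\mathbf X}'$ has the subspace detection property. -/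

import Mathlib

open scoped RealInnerProductSpace

namespace CompressedSSC

/-- `ℝⁿ` with the Euclidean norm. -/
abbrev Vec (n : ℕ) : Type := EuclideanSpace ℝ (Fin n)

section Lasso

variable {n N : ℕ}

/-- The Lasso self-regression objective `‖xᵢ - X c‖₂² + 2 λ ‖c‖₁` for the `i`-th column. -/
noncomputable def lassoObjective (X : Fin N → Vec n) (lam : ℝ) (i : Fin N) (c : Fin N → ℝ) : ℝ :=
  ‖X i - ∑ j, c j • X j‖ ^ 2 + 2 * lam * ∑ j, |c j|

/-- `c` is an optimal solution of the Lasso problem of column `i`, with the constraint `cᵢ = 0`. -/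
def IsLassoSolution (X : Fin N → Vec n) (lam : ℝ) (i : Fin N) (c : Fin N → ℝ) : Prop :=
  c i = 0 ∧ ∀ c' : Fin N → ℝ, c' i = 0 → lassoObjective X lam i c ≤ lassoObjective X lam i c'

/-- `C` is an output of Lasso SSC: for each `i` the vector `C i` is a Lasso solution. -/
def IsLassoSSCOutput (X : Fin N → Vec n) (lam : ℝ) (C : Fin N → Fin N → ℝ) : Prop :=
  ∀ i, IsLassoSolution X lam i (C i)

/-- The subspace detection property of a similarity matrix, where `label i` is the cluster of the
`i`-th data point: each `C i` is non-trivial and has no false connection. -/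
def SubspaceDetection {k : ℕ} (label : Fin N → Fin k) (C : Fin N → Fin N → ℝ) : Prop :=
  ∀ i, C i ≠ 0 ∧ ∀ j, C i j ≠ 0 → label i = label j

/-- Lasso SSC on `X` has the subspace detection property: the Lasso problems are solvable, and the
property holds whichever optimal solutions are returned. -/
def LassoSSCDetects {k : ℕ} (X : Fin N → Vec n) (label : Fin N → Fin k) (lam : ℝ) : Prop :=
  (∃ C, IsLassoSSCOutput X lam C) ∧
    ∀ C, IsLassoSSCOutput X lam C → SubspaceDetection label C

end Lasso

section Dual

variable {n : ℕ} {ι : Type*}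

/-- `ν` maximizes `⟪x, ν⟫ - (λ/2) ⟪ν, ν⟫` subject to `‖Aᵀ ν‖_∞ ≤ 1`, where the `A j` are the
columns of the matrix `A`. -/
def IsDualDirection (lam : ℝ) (x : Vec n) (A : ι → Vec n) (ν : Vec n) : Prop :=
  (∀ j, |⟪A j, ν⟫| ≤ 1) ∧
    ∀ ν' : Vec n, (∀ j, |⟪A j, ν'⟫| ≤ 1) →
      ⟪x, ν'⟫ - lam / 2 * ⟪ν', ν'⟫ ≤ ⟪x, ν⟫ - lam / 2 * ⟪ν, ν⟫

theorem existsUnique_isDualDirection {lam : ℝ} (hlam : 0 < lam) (x : Vec n) (A : ι → Vec n) :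
    ∃! ν, IsDualDirection lam x A ν := by
  set K : Set (Vec n) := {ν | ∀ j, |⟪A j, ν⟫| ≤ 1} with hK
  have hconv : Convex ℝ K := by
    intro a ha b hb s t hs ht hst j
    have h1 := abs_le.1 (ha j)
    have h2 := abs_le.1 (hb j)
    rw [inner_add_right, inner_smul_right, inner_smul_right, abs_le]
    constructor <;> nlinarith
  have hclosed : IsClosed K := by
    have : K = ⋂ j, {ν | |⟪A j, ν⟫| ≤ 1} := by ext; simp [hK]
    rw [this]
    exact isClosed_iInter fun j => isClosed_le (by fun_prop) continuous_const
  have hne : K.Nonempty := ⟨0, fun j => by simp⟩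
  have hsq : ∀ ν : Vec n, ⟪x, ν⟫ - lam / 2 * ⟪ν, ν⟫
      = 1 / (2 * lam) * ‖x‖ ^ 2 - lam / 2 * ‖lam⁻¹ • x - ν‖ ^ 2 := by
    intro ν
    rw [@norm_sub_sq_real, real_inner_self_eq_norm_sq, norm_smul, inner_smul_left, mul_pow,
      Real.norm_eq_abs, sq_abs]
    simp only [RCLike.conj_to_real]
    field_simp
    ring
  obtain ⟨ν, hν, hmin⟩ :=
    exists_norm_eq_iInf_of_complete_convex hne hclosed.isComplete hconv (lam⁻¹ • x)
  have hle : ∀ w ∈ K, ‖lam⁻¹ • x - ν‖ ≤ ‖lam⁻¹ • x - w‖ := by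
    intro w hw
    rw [hmin]
    exact ciInf_le ⟨0, by rintro _ ⟨w, rfl⟩; exact norm_nonneg _⟩ (⟨w, hw⟩ : K)
  refine ⟨ν, ⟨hν, fun w hw => ?_⟩, ?_⟩
  · rw [hsq, hsq]
    have := pow_le_pow_left₀ (norm_nonneg _) (hle w hw) 2
    nlinarith
  · rintro w ⟨hw, hwmax⟩
    have hin := (norm_eq_iInf_iff_real_inner_le_zero hconv hν).1 hmin w hw
    have h1 := hwmax ν hν
    rw [hsq, hsq] at h1
    have h2 : ‖lam⁻¹ • x - w‖ ^ 2 ≤ ‖lam⁻¹ • x - ν‖ ^ 2 := by nlinarith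
    have h3 : lam⁻¹ • x - w = (lam⁻¹ • x - ν) - (w - ν) := by abel
    rw [h3, @norm_sub_sq_real] at h2
    have h4 : ‖w - ν‖ ^ 2 ≤ 0 := by linarith
    have h5 : ‖w - ν‖ = 0 := by
      have := sq_nonneg ‖w - ν‖
      exact pow_eq_zero_iff (two_ne_zero) |>.1 (le_antisymm h4 this)
    exact sub_eq_zero.1 (norm_eq_zero.1 h5)

open Classical in
/-- The dual direction, i.e. the solution of the dual problem. It exists and is unique for
`λ > 0`, by `existsUnique_isDualDirection`; the value for other `λ` is irrelevant. -/
noncomputable def dualDirection (lam : ℝ) (x : Vec n) (A : ι → Vec n) : Vec n :=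
  if h : ∃ ν, IsDualDirection lam x A ν then h.choose else 0

theorem dualDirection_spec {lam : ℝ} (hlam : 0 < lam) (x : Vec n) (A : ι → Vec n) :
    IsDualDirection lam x A (dualDirection lam x A) := by
  have h : ∃ ν, IsDualDirection lam x A ν := (existsUnique_isDualDirection hlam x A).exists
  rw [dualDirection, dif_pos h]
  exact h.choose_spec

/-- The symmetric convex hull `conv(±a₁, …, ±a_N)` of the columns of `A`. -/
def symmHull (A : ι → Vec n) : Set (Vec n) :=
  convexHull ℝ (Set.range A ∪ Set.range fun j => -A j)

/-- The radius of the largest ball of the subspace `U` that is inscribed in `Q ⊆ U`. -/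
noncomputable def inradius (U : Submodule ℝ (Vec n)) (Q : Set (Vec n)) : ℝ :=
  sSup {r : ℝ | 0 ≤ r ∧ ∃ c ∈ U, Metric.closedBall c r ∩ (U : Set (Vec n)) ⊆ Q}

end Dual

section Geometry

variable {d N k : ℕ}

/-- The columns of the `label i`-th cluster, the `i`-th column left out. -/
def clusterWithout (X : Fin N → Vec d) (label : Fin N → Fin k) (i : Fin N) :
    {j : Fin N // label j = label i ∧ j ≠ i} → Vec d :=
  fun j => X j

/-- The normalized projected dual direction `v(xᵢ) = P ν(xᵢ) / ‖P ν(xᵢ)‖`, where `P` is the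
orthogonal projection onto the subspace of `xᵢ`, and `ν(xᵢ)` is the dual direction of `xᵢ` with
respect to the other columns of its cluster. -/
noncomputable def projectedDual (U : Fin k → Submodule ℝ (Vec d)) (label : Fin N → Fin k)
    (lam : ℝ) (X : Fin N → Vec d) (i : Fin N) : Vec d :=
  let w := (U (label i)).starProjection (dualDirection lam (X i) (clusterWithout X label i))
  ‖w‖⁻¹ • w

/-- Subspace incoherence `μ_ℓ` of the (noisy) data `X`: the maximum of `|⟪v(xᵢ), xⱼ⟫|` over `xᵢ` in
the `ℓ`-th cluster and `xⱼ` outside of it (`0` if there is only one cluster). -/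
noncomputable def incoherence (U : Fin k → Submodule ℝ (Vec d)) (label : Fin N → Fin k)
    (lam : ℝ) (X : Fin N → Vec d) (l : Fin k) : ℝ :=
  ⨆ i : {i : Fin N // label i = l}, ⨆ j : {j : Fin N // label j ≠ l},
    |⟪projectedDual U label lam X i, X j⟫|

/-- Inradius `ρ_ℓ` of the uncorrupted data `Y`: the minimum over the points `i` of the `ℓ`-th
cluster of the inradius of the symmetric convex hull of the other points of that cluster. -/
noncomputable def clusterInradius (U : Fin k → Submodule ℝ (Vec d)) (label : Fin N → Fin k)
    (Y : Fin N → Vec d) (l : Fin k) : ℝ :=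
  ⨅ i : {i : Fin N // label i = l}, inradius (U l) (symmHull (clusterWithout Y label i))

/-- `ρ = min_ℓ ρ_ℓ`. -/
noncomputable def minInradius (U : Fin k → Submodule ℝ (Vec d)) (label : Fin N → Fin k)
    (Y : Fin N → Vec d) : ℝ :=
  ⨅ l, clusterInradius U label Y l

/-- The geometric gap `Δ = min_ℓ (ρ_ℓ - μ_ℓ)` for the noisy data `X = Y + Z`. -/
noncomputable def gap (U : Fin k → Submodule ℝ (Vec d)) (label : Fin N → Fin k)
    (lam : ℝ) (Y Z : Fin N → Vec d) : ℝ :=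
  ⨅ l, (clusterInradius U label Y l - incoherence U label lam (Y + Z) l)

/-- `Ψ` is `ε`-well-behaved: it approximately preserves inner products on each pair of subspaces,
and the norms of the observed points and of the noise vectors. -/
structure WellBehaved {p : ℕ} (Ψ : Vec d →ₗ[ℝ] Vec p) (U : Fin k → Submodule ℝ (Vec d))
    (X Z : Fin N → Vec d) (ε : ℝ) : Prop where
  inner_approx : ∀ l l' : Fin k, ∀ x ∈ (U l : Set (Vec d)) ∪ U l', ∀ y ∈ (U l : Set (Vec d)) ∪ U l',
    |⟪x, y⟫ - ⟪Ψ x, Ψ y⟫| ≤ ε * ((‖x‖ ^ 2 + ‖y‖ ^ 2) / 2)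
  norm_data : ∀ i, (1 - ε) * ‖X i‖ ^ 2 ≤ ‖Ψ (X i)‖ ^ 2 ∧ ‖Ψ (X i)‖ ^ 2 ≤ (1 + ε) * ‖X i‖ ^ 2
  norm_noise : ∀ i, (1 - ε) * ‖Z i‖ ^ 2 ≤ ‖Ψ (Z i)‖ ^ 2 ∧ ‖Ψ (Z i)‖ ^ 2 ≤ (1 + ε) * ‖Z i‖ ^ 2

/-- The compressed data: the projected uncorrupted columns `Ψ yᵢ` are scaled to unit norm, and the
projected noise `Ψ zᵢ` is added. -/
noncomputable def compressed {p : ℕ} (Ψ : Vec d →ₗ[ℝ] Vec p) (Y Z : Fin N → Vec d) :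
    Fin N → Vec p :=
  fun i => ‖Ψ (Y i)‖⁻¹ • Ψ (Y i) + Ψ (Z i)

end Geometry

end CompressedSSC

namespace CompressedSSC

/-! False connections are excluded by a dual certificate. Solve the Lasso problem of a point with
the columns of its own cluster only; the residual divided by `lam` is the dual direction `ν` of that
restricted problem (`exists_dualDirection_certificate`). If `ν` has inner product of modulus below 1
with every column outside the cluster, weak duality makes every solution of the full problem vanish
there.

Incoherence controls such products only for the uncompressed noisy data, so two dual directions must
be compared. Both are compared with `ν₀`, the dual direction of the noiseless points, which lies in
the cluster subspace `U`. Write the compressed one as `ν = Ψ w + q` with `w ∈ U` and `q` orthogonal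
to `Ψ U`. The part `q` is of order noise over `lam` (`mul_norm_orthogonal_le`). After a slight
shrinking, `w` is feasible for the noiseless problem and `Ψ ν₀` for the compressed one, and the
objectives nearly agree; strong concavity then gives `‖w - ν₀‖² ≲ e / (lam ρ²)` with `e = max ε η`,
so `ρ ‖w - ν₀‖` is a small fraction of the gap (`dualDirection_perturbation`). The same lemma with
`Ψ = id` treats the uncompressed noisy data. Since the inradius bounds `‖w‖` by about `1 / ρ`, the
products off the cluster are at most about `μ / ρ`, and the gap absorbs the errors
(`abs_inner_lt_one_of_perturbation`).

Solutions are nonzero because a zero solution would make all correlations inside the cluster at most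
`lam`, which the inradius forbids (`inradius_mul_le_of_abs_inner_le`). -/

theorem nonpos_of_forall_mul_le_sq_mul {g B : ℝ} (hB : 0 ≤ B)
    (h : ∀ τ : ℝ, 0 < τ → τ ≤ 1 → τ * g ≤ τ ^ 2 * B) : g ≤ 0 := by
  by_contra hg
  push Not at hg
  have hs : 0 < g + B := by linarith
  -- This `τ` leaves the explicit surplus `g ^ 3 / (g + B) ^ 2`, and stays admissible when `B = 0`.
  have h1 := h (g / (g + B)) (by positivity) (by rw [div_le_one hs]; linarith)
  have h2 : (g / (g + B)) * g - (g / (g + B)) ^ 2 * B = g ^ 3 / (g + B) ^ 2 := by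
    field_simp
    ring
  have h3 : 0 < g ^ 3 / (g + B) ^ 2 := by positivity
  linarith

/-! ### Optimality in the dual problem, and the inradius as a bound on dual norms. -/

section Dual

variable {n : ℕ} {ι : Type*}

/-- Strong concavity of the dual objective, at its maximizer. -/
theorem IsDualDirection.strong_concavity {lam : ℝ} (hlam : 0 < lam) {x : Vec n} {A : ι → Vec n}
    {ν : Vec n} (h : IsDualDirection lam x A ν) {w : Vec n} (hw : ∀ j, |⟪A j, w⟫| ≤ 1) :
    ⟪x, w⟫ - lam / 2 * ‖w‖ ^ 2 + lam / 2 * ‖w - ν‖ ^ 2 ≤ ⟪x, ν⟫ - lam / 2 * ‖ν‖ ^ 2 := by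
  obtain ⟨hν, hmax⟩ := h
  -- First-order optimality along the segment from `ν` to `w`, which is feasible by convexity. The
  -- quadratic objective has no further terms, so this yields the claim.
  have key : ⟪x - lam • ν, w - ν⟫ ≤ 0 := by
    refine nonpos_of_forall_mul_le_sq_mul (B := lam / 2 * ‖w - ν‖ ^ 2) (by positivity) ?_
    intro τ h0 h1
    have h2 := hmax (ν + τ • (w - ν)) (fun j => by
      have ha := abs_le.1 (hν j)
      have hb := abs_le.1 (hw j)
      rw [inner_add_right, inner_smul_right, inner_sub_right, abs_le]
      constructor <;> nlinarith)
    rw [real_inner_self_eq_norm_sq, real_inner_self_eq_norm_sq, norm_add_sq_real, norm_smul,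
      inner_add_right, inner_smul_right, inner_smul_right, mul_pow, Real.norm_eq_abs, sq_abs] at h2
    rw [inner_sub_left, inner_smul_left]
    simp only [RCLike.conj_to_real]
    nlinarith
  have hw2 : ‖w‖ ^ 2 = ‖ν‖ ^ 2 + 2 * ⟪ν, w - ν⟫ + ‖w - ν‖ ^ 2 := by
    rw [← norm_add_sq_real]; congr 2; abel
  rw [inner_sub_left, inner_smul_left] at key
  simp only [RCLike.conj_to_real] at key
  have hx : ⟪x, w⟫ = ⟪x, ν⟫ + ⟪x, w - ν⟫ := by rw [inner_sub_right]; ring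
  rw [hw2, hx]
  nlinarith

theorem IsDualDirection.inner_le {lam : ℝ} (hlam : 0 < lam) {x : Vec n} {A : ι → Vec n}
    {ν : Vec n} (h : IsDualDirection lam x A ν) {w : Vec n} (hw : ∀ j, |⟪A j, w⟫| ≤ 1) :
    ⟪x - lam • ν, w - ν⟫ ≤ 0 := by
  have h1 := h.strong_concavity hlam hw
  have hw2 : ‖w‖ ^ 2 = ‖ν‖ ^ 2 + 2 * ⟪ν, w - ν⟫ + ‖w - ν‖ ^ 2 := by
    rw [← norm_add_sq_real]; congr 2; abel
  have hx : ⟪x, w⟫ = ⟪x, ν⟫ + ⟪x, w - ν⟫ := by rw [inner_sub_right]; ring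
  rw [inner_sub_left, inner_smul_left]
  simp only [RCLike.conj_to_real]
  rw [hw2, hx] at h1
  nlinarith

theorem inner_smul_inv_le_one {a b : Vec n} {m : ℝ} (hm : 0 < m) (h : |⟪a, b⟫| ≤ m) :
    |⟪a, m⁻¹ • b⟫| ≤ 1 := by
  rw [inner_smul_right, abs_mul, abs_of_pos (inv_pos.2 hm), inv_mul_le_iff₀ hm]
  simpa using h

/-- The inradius bounds the dual norm from below on the subspace. -/
theorem inradius_mul_norm_le {U : Submodule ℝ (Vec n)} {A : ι → Vec n} {w : Vec n} (hw : w ∈ U)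
    {M : ℝ} (hM : 0 ≤ M) (h : ∀ j, |⟪A j, w⟫| ≤ M) : inradius U (symmHull A) * ‖w‖ ≤ M := by
  rcases eq_or_ne w 0 with rfl | hw0
  · simpa using hM
  have hwp : 0 < ‖w‖ := norm_pos_iff.2 hw0
  rw [← le_div_iff₀ hwp]
  refine Real.sSup_le ?_ (by positivity)
  rintro r ⟨hr, c, hc, hsub⟩
  have hQ : ∀ q ∈ symmHull A, ⟪w, q⟫ ≤ M := by
    intro q hq
    have hconv : Convex ℝ {q : Vec n | ⟪w, q⟫ ≤ M} :=
      convex_halfSpace_le (innerₗ (Vec n) w).isLinear M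
    refine convexHull_min ?_ hconv hq
    rintro _ (⟨j, rfl⟩ | ⟨j, rfl⟩)
    · have := (abs_le.1 (h j)).2
      rw [real_inner_comm] at this
      exact this
    · have := (abs_le.1 (h j)).1
      rw [real_inner_comm] at this
      simp only [Set.mem_ofPred_eq, inner_neg_right]
      linarith
  -- The inscribed ball need not be centred at the origin. Testing its two antipodal points in the
  -- direction of `w`, with the upper bound at one and the lower bound at the other, cancels the
  -- centre `c`.
  have hmem : ∀ s : ℝ, |s| = r → ⟪w, c + (s / ‖w‖) • w⟫ ≤ M := by
    intro s hs
    refine hQ _ (hsub ⟨?_, U.add_mem hc (U.smul_mem _ hw)⟩)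
    rw [Metric.mem_closedBall, dist_eq_norm, add_sub_cancel_left, norm_smul, Real.norm_eq_abs,
      abs_div, abs_norm, div_mul_cancel₀ _ hwp.ne', hs]
  have h1 := hmem r (abs_of_nonneg hr)
  rw [le_div_iff₀ hwp]
  have hneg : ⟪w, -c + (r / ‖w‖) • w⟫ ≤ M := by
    have hQ' : ∀ q ∈ symmHull A, -⟪w, q⟫ ≤ M := by
      intro q hq
      have hconv : Convex ℝ {q : Vec n | -M ≤ ⟪w, q⟫} :=
        convex_halfSpace_ge (innerₗ (Vec n) w).isLinear (-M)
      have : q ∈ {q : Vec n | -M ≤ ⟪w, q⟫} := by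
        refine convexHull_min ?_ hconv hq
        rintro _ (⟨j, rfl⟩ | ⟨j, rfl⟩)
        · have := (abs_le.1 (h j)).1
          rw [real_inner_comm] at this
          exact this
        · have := (abs_le.1 (h j)).2
          rw [real_inner_comm] at this
          simp only [Set.mem_ofPred_eq, inner_neg_right]
          linarith
      have h3 : -M ≤ ⟪w, q⟫ := this
      linarith
    have h2 := hQ' (c + ((-r) / ‖w‖) • w) (hsub ⟨by
      rw [Metric.mem_closedBall, dist_eq_norm, add_sub_cancel_left, norm_smul, Real.norm_eq_abs,
        abs_div, abs_norm, div_mul_cancel₀ _ hwp.ne', abs_neg, abs_of_nonneg hr],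
      U.add_mem hc (U.smul_mem _ hw)⟩)
    rw [← inner_neg_right] at h2
    convert h2 using 2
    rw [neg_add, ← neg_smul]
    congr 2
    ring
  rw [inner_add_right, inner_smul_right, real_inner_self_eq_norm_sq] at h1 hneg
  rw [inner_neg_right] at hneg
  have h4 : r / ‖w‖ * ‖w‖ ^ 2 = r * ‖w‖ := by field_simp
  linarith

end Dual

/-! ### Lasso solutions: existence, optimality conditions, dual certificates. -/

section Lasso

variable {n N : ℕ}

/-- The Lasso problem restricted to the coefficient vectors supported in `S` is solvable. -/
theorem exists_lassoObjective_minimizer (X : Fin N → Vec n) {lam : ℝ} (hlam : 0 < lam) (i : Fin N)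
    (S : Set (Fin N)) :
    ∃ c : Fin N → ℝ, (∀ j ∉ S, c j = 0) ∧ ∀ c' : Fin N → ℝ, (∀ j ∉ S, c' j = 0) →
      lassoObjective X lam i c ≤ lassoObjective X lam i c' := by
  set K : Set (Fin N → ℝ) := {c | ∀ j ∉ S, c j = 0} with hK
  have hclosed : IsClosed K := by
    have : K = ⋂ j, ⋂ (_ : j ∉ S), {c | c j = 0} := by ext; simp [hK]
    rw [this]
    exact isClosed_iInter fun j => isClosed_iInter fun _ =>
      isClosed_eq (continuous_apply j) continuous_const
  have hcont : Continuous (lassoObjective X lam i) := by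
    unfold lassoObjective
    fun_prop
  have h0 : (0 : Fin N → ℝ) ∈ K := fun j _ => rfl
  set R : ℝ := lassoObjective X lam i 0 / (2 * lam) with hR
  obtain ⟨c, hcK, hc⟩ := hcont.continuousOn.exists_isMinOn' hclosed h0 (by
    rw [Filter.eventually_inf_principal]
    have : ∀ᶠ c in Filter.cocompact (Fin N → ℝ), R < ‖c‖ :=
      (tendsto_norm_cocompact_atTop (E := Fin N → ℝ)).eventually_gt_atTop R
    filter_upwards [this] with c hc _
    -- The norm on `Fin N → ℝ` is the sup norm, so the penalty dominates it and makes the objective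
    -- coercive.
    have h1 : ‖c‖ ≤ ∑ j, |c j| := by
      refine (pi_norm_le_iff_of_nonneg (Finset.sum_nonneg fun j _ => abs_nonneg _)).2 fun j => ?_
      exact Finset.single_le_sum (f := fun j => |c j|) (fun j _ => abs_nonneg _)
        (Finset.mem_univ j)
    have h2 : lassoObjective X lam i 0 < 2 * lam * ‖c‖ := by
      rw [hR, div_lt_iff₀ (by positivity)] at hc
      linarith
    have h3 : 2 * lam * ‖c‖ ≤ lassoObjective X lam i c := by
      unfold lassoObjective
      have := mul_le_mul_of_nonneg_left h1 (by positivity : 0 ≤ 2 * lam)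
      nlinarith [sq_nonneg ‖X i - ∑ j, c j • X j‖]
    linarith)
  exact ⟨c, hcK, fun c' hc' => hc hc'⟩

/-- The optimality conditions of the restricted Lasso problem. -/
theorem lasso_kkt {X : Fin N → Vec n} {lam : ℝ} (hlam : 0 < lam) {i : Fin N}
    {S : Set (Fin N)} {c : Fin N → ℝ} (hc : ∀ j ∉ S, c j = 0)
    (hmin : ∀ c' : Fin N → ℝ, (∀ j ∉ S, c' j = 0) →
      lassoObjective X lam i c ≤ lassoObjective X lam i c') {j : Fin N} (hj : j ∈ S) :
    |⟪X j, X i - ∑ l, c l • X l⟫| ≤ lam ∧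
      c j * ⟪X j, X i - ∑ l, c l • X l⟫ = lam * |c j| := by
  set r := X i - ∑ l, c l • X l with hr
  set g := ⟪X j, r⟫ with hg
  have hvar : ∀ t : ℝ, 0 ≤ -2 * t * g + t ^ 2 * ‖X j‖ ^ 2 + 2 * lam * (|c j + t| - |c j|) := by
    intro t
    have h1 := hmin (c + Pi.single j t) (fun l hl => by
      have : l ≠ j := fun h => hl (h ▸ hj)
      simp [this, hc l hl])
    have h2 : X i - ∑ l, (c + Pi.single j t : Fin N → ℝ) l • X l = r - t • X j := by
      simp [add_smul, Finset.sum_add_distrib, hr, Pi.single_apply, ite_smul, sub_sub]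
    have h3 : ∑ l, |(c + Pi.single j t : Fin N → ℝ) l| = ∑ l, |c l| + (|c j + t| - |c j|) := by
      rw [← sub_eq_iff_eq_add', ← Finset.sum_sub_distrib, Finset.sum_eq_single j]
      · simp
      · intro b _ hb
        simp [hb]
      · simp
    unfold lassoObjective at h1
    rw [h2, h3, ← hr, norm_sub_sq_real r, norm_smul, inner_smul_right, real_inner_comm, mul_pow,
      Real.norm_eq_abs, sq_abs] at h1
    rw [← hg] at h1
    linarith
  have hup : g ≤ lam := by
    rw [← sub_nonpos]
    refine nonpos_of_forall_mul_le_sq_mul (B := ‖X j‖ ^ 2 / 2) (by positivity) fun τ h0 _ => ?_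
    have h1 := hvar τ
    have h2 : |c j + τ| ≤ |c j| + τ := by simpa [abs_of_pos h0] using abs_add_le (c j) τ
    nlinarith
  have hlo : -g ≤ lam := by
    rw [← sub_nonpos]
    refine nonpos_of_forall_mul_le_sq_mul (B := ‖X j‖ ^ 2 / 2) (by positivity) fun τ h0 _ => ?_
    have h1 := hvar (-τ)
    have h2 : |c j + -τ| ≤ |c j| + τ := by simpa [abs_of_pos h0] using abs_add_le (c j) (-τ)
    nlinarith
  have habs : |g| ≤ lam := abs_le.2 ⟨by linarith, hup⟩
  refine ⟨habs, le_antisymm ?_ ?_⟩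
  · calc c j * g ≤ |c j * g| := le_abs_self _
      _ = |c j| * |g| := abs_mul _ _
      _ ≤ |c j| * lam := by gcongr
      _ = lam * |c j| := mul_comm _ _
  -- Complementary slackness: shrinking `c j` by the factor `1 - τ` gains exactly `τ |c j|` in the
  -- penalty.
  · rw [← sub_nonpos]
    refine nonpos_of_forall_mul_le_sq_mul (B := c j ^ 2 * ‖X j‖ ^ 2 / 2) (by positivity)
      fun τ h0 h1 => ?_
    have h2 := hvar (-τ * c j)
    have h3 : |c j + -τ * c j| = (1 - τ) * |c j| := by
      rw [show c j + -τ * c j = (1 - τ) * c j by ring, abs_mul, abs_of_nonneg (by linarith)]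
    rw [h3] at h2
    nlinarith

theorem sum_smul_inner_left (X : Fin N → Vec n) (c : Fin N → ℝ) (w : Vec n) :
    ⟪∑ l, c l • X l, w⟫ = ∑ l, c l * ⟪X l, w⟫ := by
  simp [sum_inner, inner_smul_left]

/-- The scaled residual of the Lasso problem restricted to a cluster is the dual direction. If it is
strictly feasible off the cluster, no Lasso solution leaves the cluster. -/
theorem exists_dualDirection_certificate {k : ℕ} (X : Fin N → Vec n) (label : Fin N → Fin k)
    {lam : ℝ} (hlam : 0 < lam) (i : Fin N) :
    ∃ ν, IsDualDirection lam (X i) (clusterWithout X label i) ν ∧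
      ((∀ j, label j ≠ label i → |⟪X j, ν⟫| < 1) →
        ∀ c, IsLassoSolution X lam i c → ∀ j, c j ≠ 0 → label i = label j) := by
  obtain ⟨a, ha, hamin⟩ :=
    exists_lassoObjective_minimizer X hlam i {j | label j = label i ∧ j ≠ i}
  have hkkt := fun j hj => lasso_kkt hlam ha hamin (j := j) hj
  set r := X i - ∑ l, a l • X l with hr
  have hx : X i = r + ∑ l, a l • X l := by rw [hr]; abel
  have hfeas : ∀ j, label j = label i ∧ j ≠ i → |⟪X j, lam⁻¹ • r⟫| ≤ 1 := fun j hj =>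
    inner_smul_inv_le_one hlam (hkkt j hj).1
  have hslack : ∀ j, a j * ⟪X j, lam⁻¹ • r⟫ = |a j| := by
    intro j
    by_cases hj : label j = label i ∧ j ≠ i
    · rw [inner_smul_right, mul_left_comm, (hkkt j hj).2, inv_mul_cancel_left₀ hlam.ne']
    · simp [ha j hj]
  have hrν : r = lam • (lam⁻¹ • r) := by rw [smul_smul, mul_inv_cancel₀ hlam.ne', one_smul]
  set ν := lam⁻¹ • r with hν
  have hval : ⟪X i, ν⟫ = lam * ‖ν‖ ^ 2 + ∑ j, |a j| := by
    rw [hx, inner_add_left, sum_smul_inner_left, hrν, inner_smul_left, real_inner_self_eq_norm_sq]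
    simp [hslack]
  refine ⟨ν, ⟨fun j => hfeas j j.2, fun w hw => ?_⟩, fun hout c hc j hj => ?_⟩
  · have h1 : ⟪X i, w⟫ ≤ lam * ⟪ν, w⟫ + ∑ j, |a j| := by
      rw [hx, inner_add_left, sum_smul_inner_left, hrν, inner_smul_left]
      simp only [RCLike.conj_to_real]
      gcongr with j
      by_cases hj : label j = label i ∧ j ≠ i
      · have h2 : |⟪X j, w⟫| ≤ 1 := hw ⟨j, hj⟩
        calc a j * ⟪X j, w⟫ ≤ |a j * ⟪X j, w⟫| := le_abs_self _
          _ = |a j| * |⟪X j, w⟫| := abs_mul _ _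
          _ ≤ |a j| * 1 := by gcongr
          _ = |a j| := mul_one _
      · simp [ha j hj]
    rw [hval, real_inner_self_eq_norm_sq, real_inner_self_eq_norm_sq]
    have h3 : 0 ≤ ‖ν - w‖ ^ 2 := by positivity
    rw [@norm_sub_sq_real] at h3
    nlinarith
  · obtain ⟨hci, hcmin⟩ := hc
    have h1 := hcmin a (ha i (by simp))
    unfold lassoObjective at h1
    rw [← hr] at h1
    set s := X i - ∑ l, c l • X l with hs
    have hsν : ⟪s, ν⟫ = ⟪X i, ν⟫ - ∑ l, c l * ⟪X l, ν⟫ := by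
      rw [hs, inner_sub_left, sum_smul_inner_left]
    -- Weak duality for the competitor's residual `s`. With the optimality of `c` against `a`, it
    -- forces the sum of the nonnegative slacks `|c l| - c l * ⟪X l, ν⟫` to be at most 0.
    have h2 : 2 * lam * ⟪s, ν⟫ - lam ^ 2 * ‖ν‖ ^ 2 ≤ ‖s‖ ^ 2 := by
      have h3 : 0 ≤ ‖s - lam • ν‖ ^ 2 := by positivity
      rw [@norm_sub_sq_real, inner_smul_right, norm_smul, mul_pow, Real.norm_eq_abs, sq_abs] at h3
      linarith
    have h4 : ‖r‖ ^ 2 = lam ^ 2 * ‖ν‖ ^ 2 := by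
      rw [hrν, norm_smul, mul_pow, Real.norm_eq_abs, sq_abs]
    have hterm : ∀ l, 0 ≤ |c l| - c l * ⟪X l, ν⟫ := by
      intro l
      have hl : c l = 0 ∨ |⟪X l, ν⟫| ≤ 1 := by
        by_cases hli : l = i
        · left; rw [hli, hci]
        · right
          by_cases hll : label l = label i
          · exact hfeas l ⟨hll, hli⟩
          · exact (hout l hll).le
      rcases hl with hl | hl
      · simp [hl]
      · have : c l * ⟪X l, ν⟫ ≤ |c l| * 1 := (le_abs_self _).trans (by rw [abs_mul]; gcongr)
        linarith
    have hsum : ∑ l, (|c l| - c l * ⟪X l, ν⟫) ≤ 0 := by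
      rw [Finset.sum_sub_distrib]
      rw [hsν, hval] at h2
      rw [h4] at h1
      nlinarith
    have hzero : |c j| - c j * ⟪X j, ν⟫ = 0 :=
      (Finset.sum_eq_zero_iff_of_nonneg fun l _ => hterm l).1
        (le_antisymm hsum (Finset.sum_nonneg fun l _ => hterm l)) j (Finset.mem_univ j)
    by_contra hne
    have hlt := hout j (fun h => hne h.symm)
    have : c j * ⟪X j, ν⟫ < |c j| := by
      refine (le_abs_self _).trans_lt ?_
      rw [abs_mul]
      exact mul_lt_of_lt_one_right (abs_pos.2 hj) hlt
    linarith

end Lasso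

/-! ### Stability of the dual direction under compression and noise. -/

section Perturbation

variable {d p : ℕ}

/-- Compression costs `e ‖w‖` in the inner product, and normalizing costs another `|1 - ‖Ψ y‖|`
times `‖Ψ w‖`; the former factor is at most `|1 - ‖Ψ y‖ ^ 2|`. -/
theorem abs_inner_normalized_sub_le {Ψ : Vec d →ₗ[ℝ] Vec p} {e : ℝ} {y w : Vec d} (he1 : e < 1)
    (hy : |1 - ‖Ψ y‖ ^ 2| ≤ e) (hw : ‖Ψ w‖ ≤ (1 + e) * ‖w‖)
    (hyw : |⟪y, w⟫ - ⟪Ψ y, Ψ w⟫| ≤ e * ‖w‖) :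
    |⟪‖Ψ y‖⁻¹ • Ψ y, Ψ w⟫ - ⟪y, w⟫| ≤ 3 * e * ‖w‖ := by
  set α := ‖Ψ y‖ with hα
  have he0 : 0 ≤ e := (abs_nonneg _).trans hy
  have hα0 : 0 < α := by
    rcases (norm_nonneg (Ψ y)).eq_or_lt with h | h
    · rw [← hα] at h
      rw [← h] at hy
      norm_num at hy
      linarith
    · exact h
  have hα1 : |1 - α| ≤ e := by
    refine le_trans ?_ hy
    rw [show 1 - α ^ 2 = (1 - α) * (1 + α) by ring, abs_mul, abs_of_pos (by linarith : 0 < 1 + α)]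
    nlinarith [abs_nonneg (1 - α)]
  have hunit : ‖α⁻¹ • Ψ y‖ = 1 := by
    rw [norm_smul, norm_inv, Real.norm_of_nonneg hα0.le, inv_mul_cancel₀ hα0.ne']
  have hin : ⟪Ψ y, Ψ w⟫ = α * ⟪α⁻¹ • Ψ y, Ψ w⟫ := by
    rw [inner_smul_left]
    simp only [RCLike.conj_to_real]
    rw [mul_inv_cancel_left₀ hα0.ne']
  set g := ⟪α⁻¹ • Ψ y, Ψ w⟫ with hg
  have hgle : |g| ≤ ‖Ψ w‖ := by simpa [hunit] using abs_real_inner_le_norm (α⁻¹ • Ψ y) (Ψ w)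
  have h1 : g - ⟪y, w⟫ = (1 - α) * g - (⟪y, w⟫ - α * g) := by ring
  rw [hin] at hyw
  rw [h1]
  calc |(1 - α) * g - (⟪y, w⟫ - α * g)| ≤ |(1 - α) * g| + |⟪y, w⟫ - α * g| := abs_sub _ _
    _ ≤ e * ((1 + e) * ‖w‖) + e * ‖w‖ := by
      rw [abs_mul]
      exact add_le_add (mul_le_mul hα1 (hgle.trans hw) (abs_nonneg _) he0) hyw
    _ ≤ 3 * e * ‖w‖ := by nlinarith [mul_nonneg he0 (norm_nonneg w)]

theorem abs_inner_normalized_add_sub_le {Ψ : Vec d →ₗ[ℝ] Vec p} {e : ℝ} {y w : Vec d} {z : Vec p}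
    (he1 : e < 1 / 1000) (hy : |1 - ‖Ψ y‖ ^ 2| ≤ e) (hw : ‖Ψ w‖ ≤ (1 + e) * ‖w‖)
    (hyw : |⟪y, w⟫ - ⟪Ψ y, Ψ w⟫| ≤ e * ‖w‖) (hz : ‖z‖ ≤ 2 * e) :
    |⟪‖Ψ y‖⁻¹ • Ψ y + z, Ψ w⟫ - ⟪y, w⟫| ≤ 6 * e * ‖w‖ := by
  have he0 : 0 ≤ e := (abs_nonneg _).trans hy
  have h1 := abs_inner_normalized_sub_le (by linarith) hy hw hyw
  have h2 : |⟪z, Ψ w⟫| ≤ 3 * e * ‖w‖ := by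
    calc |⟪z, Ψ w⟫| ≤ ‖z‖ * ‖Ψ w‖ := abs_real_inner_le_norm _ _
      _ ≤ (2 * e) * ((1 + e) * ‖w‖) := mul_le_mul hz hw (norm_nonneg _) (by linarith)
      _ ≤ 3 * e * ‖w‖ := by nlinarith [mul_nonneg he0 (norm_nonneg w)]
  rw [inner_add_left, add_sub_right_comm]
  refine (abs_add_le _ _).trans ?_
  linarith

theorem norm_map_sq_bounds {Ψ : Vec d →ₗ[ℝ] Vec p} {e : ℝ} {w : Vec d}
    (h : |⟪w, w⟫ - ⟪Ψ w, Ψ w⟫| ≤ e * ‖w‖ * ‖w‖) :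
    (1 - e) * ‖w‖ ^ 2 ≤ ‖Ψ w‖ ^ 2 ∧ ‖Ψ w‖ ^ 2 ≤ (1 + e) * ‖w‖ ^ 2 := by
  rw [real_inner_self_eq_norm_sq, real_inner_self_eq_norm_sq, abs_le] at h
  constructor <;> linarith

theorem norm_map_le {Ψ : Vec d →ₗ[ℝ] Vec p} {e : ℝ} {w : Vec d} (he : 0 ≤ e)
    (h : |⟪w, w⟫ - ⟪Ψ w, Ψ w⟫| ≤ e * ‖w‖ * ‖w‖) : ‖Ψ w‖ ≤ (1 + e) * ‖w‖ := by
  refine abs_le_of_sq_le_sq' ?_ (by positivity) |>.2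
  have h1 := (norm_map_sq_bounds h).2
  have h2 : 0 ≤ (e + e ^ 2) * ‖w‖ ^ 2 := by positivity
  nlinarith

/-- The component of the dual direction orthogonal to the signal subspace is of the order of the
noise level over `λ`. -/
theorem mul_norm_orthogonal_le {ι : Type*} {lam h : ℝ} (hlam : 0 < lam) {x a ν b q : Vec p}
    {A ζ : ι → Vec p} (hν : IsDualDirection lam (a + x) (fun j => A j + ζ j) ν) (hbq : ν = b + q)
    (hA : ∀ j, ⟪A j, q⟫ = 0) (ha : ⟪a, q⟫ = 0) (hb : ⟪b, q⟫ = 0) (ha1 : ‖a‖ ≤ 1)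
    (hx : ‖x‖ ≤ h) (hζ : ∀ j, ‖ζ j‖ ≤ h) : lam * ‖q‖ ≤ h * (1 + (1 + h) * ‖b‖) := by
  have hh : 0 ≤ h := (norm_nonneg _).trans hx
  set t := ‖q‖ with ht
  have ht0 : 0 ≤ t := norm_nonneg _
  have hht : 0 ≤ h * t := mul_nonneg hh ht0
  set m := 1 + h * t with hm
  have hm0 : 0 < m := by linarith
  -- Only the noise sees `q`, so deleting `q` from `ν` raises a constraint by at most `h * t`;
  -- dividing by `m` restores feasibility. Testing optimality with this vector gives the bound
  -- multiplied by `t`.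
  have hfeas : ∀ j, |⟪A j + ζ j, m⁻¹ • b⟫| ≤ 1 := by
    intro j
    refine inner_smul_inv_le_one hm0 ?_
    have h1 : ⟪A j + ζ j, b⟫ = ⟪A j + ζ j, ν⟫ - ⟪ζ j, q⟫ := by
      rw [hbq, inner_add_right, inner_add_left (A j) (ζ j) q, hA]; ring
    rw [h1]
    refine (abs_sub _ _).trans (add_le_add (hν.1 j) ?_)
    exact (abs_real_inner_le_norm _ _).trans (by gcongr; exact hζ j)
  have h1 := hν.inner_le hlam hfeas
  have hs1 : 1 - m⁻¹ ≤ h * t := by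
    have : 1 - m⁻¹ = h * t / m := by field_simp; rw [hm]; ring
    rw [this]
    exact div_le_self hht (by linarith)
  have hs0 : 0 ≤ 1 - m⁻¹ := by
    rw [sub_nonneg]; exact inv_le_one_of_one_le₀ (by linarith)
  have hexp : ⟪(a + x) - lam • ν, m⁻¹ • b - ν⟫
      = -((1 - m⁻¹) * (⟪a + x, b⟫ - lam * ‖b‖ ^ 2)) - ⟪x, q⟫ + lam * t ^ 2 := by
    have hqb : ⟪q, b⟫ = 0 := by rw [real_inner_comm]; exact hb
    rw [hbq]
    simp only [inner_sub_left, inner_sub_right, inner_add_left, inner_add_right, inner_smul_left,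
      inner_smul_right, RCLike.conj_to_real, ha, hb, hqb, real_inner_self_eq_norm_sq]
    rw [← ht]
    ring
  rw [hexp] at h1
  have hxq : ⟪x, q⟫ ≤ h * t := (real_inner_le_norm _ _).trans (by gcongr)
  have hxb : ⟪a + x, b⟫ ≤ (1 + h) * ‖b‖ :=
    (real_inner_le_norm _ _).trans (by gcongr; exact (norm_add_le _ _).trans (add_le_add ha1 hx))
  have h2 : (1 - m⁻¹) * (⟪a + x, b⟫ - lam * ‖b‖ ^ 2) ≤ h * t * ((1 + h) * ‖b‖) := by
    have h3 : ⟪a + x, b⟫ - lam * ‖b‖ ^ 2 ≤ (1 + h) * ‖b‖ := by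
      have : 0 ≤ lam * ‖b‖ ^ 2 := by positivity
      linarith
    calc _ ≤ (1 - m⁻¹) * ((1 + h) * ‖b‖) := mul_le_mul_of_nonneg_left h3 hs0
      _ ≤ _ := mul_le_mul_of_nonneg_right hs1 (by positivity)
  rcases ht0.eq_or_lt with h0 | h0
  · rw [← h0]; simp only [mul_zero]; positivity
  · refine le_of_mul_le_mul_right ?_ h0
    nlinarith

/-- The dual direction of noiseless data lies in the subspace of the data. -/
theorem IsDualDirection.mem_of_mem {ι : Type*} {lam : ℝ} (hlam : 0 < lam)
    {U : Submodule ℝ (Vec d)} {y ν : Vec d} {A : ι → Vec d} (hν : IsDualDirection lam y A ν)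
    (hy : y ∈ U) (hA : ∀ j, A j ∈ U) : ν ∈ U := by
  have hq : ∀ u ∈ U, ⟪u, ν - U.starProjection ν⟫ = 0 := fun u hu =>
    Submodule.inner_right_of_mem_orthogonal hu (U.sub_starProjection_mem_orthogonal ν)
  -- Zero noise forces `q = 0`. Scaling `y` and `lam` by the same factor keeps the maximizer and
  -- secures the bound `‖a‖ ≤ 1`.
  have h1 := mul_norm_orthogonal_le (x := (0 : Vec d)) (ζ := fun _ : ι => (0 : Vec d)) (h := 0)
    (a := (‖y‖ + 1)⁻¹ • y) (lam := (‖y‖ + 1)⁻¹ * lam) (A := A) (ν := ν)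
    (b := U.starProjection ν) (q := ν - U.starProjection ν) (by positivity)
    ⟨by simpa using hν.1, fun w hw => by
      have h2 := hν.2 w (by simpa using hw)
      have h3 := mul_le_mul_of_nonneg_left h2 (by positivity : 0 ≤ (‖y‖ + 1)⁻¹)
      simp only [add_zero, inner_smul_left, RCLike.conj_to_real]
      linarith⟩ (by abel) (fun j => hq _ (hA j)) (hq _ (U.smul_mem _ hy))
    (hq _ (U.starProjection_apply_mem ν))
    (by
      rw [norm_smul, norm_inv, Real.norm_of_nonneg (by positivity), inv_mul_le_iff₀ (by positivity)]
      linarith)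
    (by simp) (by simp)
  rw [zero_mul] at h1
  have h4 : ‖ν - U.starProjection ν‖ ≤ 0 :=
    nonpos_of_mul_nonpos_right h1 (by positivity)
  rw [sub_eq_zero.1 (norm_le_zero_iff.1 h4)]
  exact U.starProjection_apply_mem ν

set_option maxHeartbeats 1000000 in
/-- Stability of the dual direction under compression and noise. -/
theorem dualDirection_perturbation {ι : Type*} {U : Submodule ℝ (Vec d)}
    {Ψ : Vec d →ₗ[ℝ] Vec p} {y ν₀ w : Vec d} {A : ι → Vec d} {ζ : ι → Vec p} {x ν q : Vec p}
    {e h ρ lam D : ℝ} (hyU : y ∈ U) (hAU : ∀ j, A j ∈ U) (hy1 : ‖y‖ = 1) (hA1 : ∀ j, ‖A j‖ = 1)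
    (hΨ : ∀ u ∈ U, ∀ v ∈ U, |⟪u, v⟫ - ⟪Ψ u, Ψ v⟫| ≤ e * ‖u‖ * ‖v‖)
    (hρ : ∀ u ∈ U, ∀ M, 0 ≤ M → (∀ j, |⟪A j, u⟫| ≤ M) → ρ * ‖u‖ ≤ M)
    (hρ0 : 0 < ρ) (hρ1 : ρ ≤ 1) (hlam : 0 < lam) (hlam1 : lam ≤ 1) (he0 : 0 ≤ e)
    (heD : e ≤ 1 / 100000 * (D ^ 2 * lam)) (hD0 : 0 < D) (hDρ : D ≤ ρ)
    (hx : ‖x‖ ≤ h) (hζ : ∀ j, ‖ζ j‖ ≤ h) (hhe : h ≤ 2 * e) (hhD : h ≤ lam * D / 20)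
    (hν₀ : IsDualDirection lam y A ν₀)
    (hν : IsDualDirection lam (‖Ψ y‖⁻¹ • Ψ y + x) (fun j => ‖Ψ (A j)‖⁻¹ • Ψ (A j) + ζ j) ν)
    (hw : w ∈ U) (hwq : ν = Ψ w + q) (hq : ∀ u ∈ U, ⟪Ψ u, q⟫ = 0) :
    ρ * ‖w‖ ≤ 1 + 15 * (e / ρ) ∧ lam * ‖q‖ ≤ h * (1 + 2 * ‖w‖) ∧ ρ * ‖w - ν₀‖ ≤ D / 20 := by
  have hν₀U : ν₀ ∈ U := hν₀.mem_of_mem hlam hyU hAU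
  have hh : 0 ≤ h := (norm_nonneg _).trans hx
  have hD1 : D ≤ 1 := hDρ.trans hρ1
  set R := ρ⁻¹ with hR
  have hRρ : ρ * R = 1 := mul_inv_cancel₀ hρ0.ne'
  have hR1 : 1 ≤ R := one_le_inv_iff₀.2 ⟨hρ0, hρ1⟩
  have heR0 : 0 ≤ e * R := by positivity
  have heR : e * R ≤ 1 / 100000 * D := by
    have h1 : D ^ 2 * lam ≤ D * ρ := by nlinarith
    calc e * R ≤ (1 / 100000 * (D * ρ)) * R := by gcongr; linarith
      _ = 1 / 100000 * D * (ρ * R) := by ring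
      _ = _ := by rw [hRρ, mul_one]
  have hee : e ≤ e * R := by nlinarith
  have heR2 : e * R ≤ e * R ^ 2 := by nlinarith
  have he1 : e < 1 / 1000 := by linarith
  have hmap : ∀ u ∈ U, ‖Ψ u‖ ≤ (1 + e) * ‖u‖ := fun u hu => norm_map_le he0 (hΨ u hu u hu)
  have hcol : ∀ v ∈ U, ‖v‖ = 1 → ∀ z : Vec p, ‖z‖ ≤ h → ∀ u ∈ U,
      |⟪‖Ψ v‖⁻¹ • Ψ v + z, Ψ u⟫ - ⟪v, u⟫| ≤ 6 * e * ‖u‖ := fun v hv hv1 z hz u hu =>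
    abs_inner_normalized_add_sub_le he1 (by simpa [hv1] using hΨ v hv v hv) (hmap u hu)
      (by simpa [hv1] using hΨ v hv u hu) (hz.trans hhe)
  have hnorm1 : ∀ v : Vec d, ‖‖Ψ v‖⁻¹ • Ψ v‖ ≤ 1 := fun v => by
    rw [norm_smul, norm_inv, norm_norm]
    exact inv_mul_le_one
  have hq' : ∀ (s : ℝ), ∀ u ∈ U, ⟪s • Ψ u, q⟫ = 0 := fun s u hu => by
    rw [inner_smul_left, hq u hu, mul_zero]
  have hq0 : lam * ‖q‖ ≤ h * (1 + (1 + h) * ‖Ψ w‖) :=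
    mul_norm_orthogonal_le hlam hν hwq (fun j => hq' _ _ (hAU j)) (hq' _ _ hyU) (hq w hw)
      (hnorm1 y) hx hζ
  set a := ‖w‖ with ha
  have ha0 : 0 ≤ a := norm_nonneg _
  set t := ‖q‖ with ht
  have ht0 : 0 ≤ t := norm_nonneg _
  have hΨw : ‖Ψ w‖ ≤ (1 + e) * a := hmap w hw
  have hq1 : lam * t ≤ h * (1 + 2 * a) := by
    have h1 : (1 + h) * ‖Ψ w‖ ≤ 2 * a := by
      calc (1 + h) * ‖Ψ w‖ ≤ (1 + h) * ((1 + e) * a) := by gcongr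
        _ = ((1 + h) * (1 + e)) * a := by ring
        _ ≤ 2 * a := by gcongr; nlinarith
    exact hq0.trans (by gcongr)
  have ht1 : t ≤ 1 + a := by
    refine le_of_mul_le_mul_left (hq1.trans ?_) hlam
    have h1 : h ≤ lam / 20 := hhD.trans (by nlinarith)
    nlinarith [mul_nonneg hlam.le ha0, mul_le_mul_of_nonneg_right h1 (by linarith : 0 ≤ 1 + 2 * a)]
  have hht : h * t ≤ e * (1 + a) := by
    have h1 : t ≤ (1 + 2 * a) / 20 := by
      refine le_of_mul_le_mul_left (hq1.trans ?_) hlam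
      have h1 : h ≤ lam / 20 := hhD.trans (by nlinarith)
      have := mul_le_mul_of_nonneg_right h1 (by linarith : 0 ≤ 1 + 2 * a)
      linarith
    calc h * t ≤ (2 * e) * ((1 + 2 * a) / 20) := by gcongr
      _ ≤ e * (1 + a) := by nlinarith [mul_nonneg he0 ha0]
  have hAw : ∀ j, |⟪A j, w⟫| ≤ 1 + e + 7 * e * a := by
    intro j
    have h1 := hcol (A j) (hAU j) (hA1 j) (ζ j) (hζ j) w hw
    have h2 : ⟪‖Ψ (A j)‖⁻¹ • Ψ (A j) + ζ j, Ψ w⟫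
        = ⟪‖Ψ (A j)‖⁻¹ • Ψ (A j) + ζ j, ν⟫ - ⟪ζ j, q⟫ := by
      rw [hwq, inner_add_right, inner_add_left _ _ q, hq' _ _ (hAU j)]; ring
    have h3 : |⟪ζ j, q⟫| ≤ h * t :=
      (abs_real_inner_le_norm _ _).trans (by gcongr; exact hζ j)
    have h4 := abs_le.1 (hν.1 j)
    rw [h2] at h1
    have h5 := abs_le.1 h1
    have h6 := abs_le.1 h3
    rw [abs_le]
    constructor <;> linarith
  have hρa : ρ * a ≤ 1 + e + 7 * e * a := hρ w hw _ (by positivity) hAw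
  have haR : a ≤ 2 * R := by
    have h1 : a = R * (ρ * a) := by rw [← mul_assoc, mul_comm R, hRρ, one_mul]
    have h2 : R * (ρ * a) ≤ R * (1 + e + 7 * e * a) := by gcongr
    have h3 : (e * R) * a ≤ 1 / 100000 * a := by gcongr; linarith
    linarith
  have hea : e * a ≤ 2 * (e * R) := by
    linarith [mul_le_mul_of_nonneg_left haR he0]
  -- The constraint excess `e + 7 * e * a` is at most `15 * (e * R)` because `a ≤ 2 * R`. The factor
  -- `s = (1 + κ)⁻¹` therefore makes `w` and `Ψ ν₀` feasible in each other's problems.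
  set κ := 15 * (e * R) with hκ
  have hκ0 : 0 ≤ κ := by positivity
  have hκ1 : 1 + e + 7 * e * a ≤ 1 + κ := by linarith
  have hm0 : 0 < 1 + κ := by linarith
  set s := (1 + κ)⁻¹ with hs
  have hs0 : 0 < s := inv_pos.2 hm0
  have hs1 : s ≤ 1 := inv_le_one_of_one_le₀ (by linarith)
  have hsκ : 1 - s ≤ κ := by
    have : s * (1 + κ) = 1 := inv_mul_cancel₀ hm0.ne'
    nlinarith
  have hn0 : ‖ν₀‖ ≤ R := by
    have := hρ ν₀ hν₀U 1 zero_le_one hν₀.1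
    rw [hR, ← one_div, le_div_iff₀ hρ0]
    linarith
  set n := ‖ν₀‖ with hn
  have hn00 : 0 ≤ n := norm_nonneg _
  have hfeas : ∀ j, |⟪‖Ψ (A j)‖⁻¹ • Ψ (A j) + ζ j, s • Ψ ν₀⟫| ≤ 1 := by
    intro j
    refine inner_smul_inv_le_one hm0 ?_
    have h1 := abs_le.1 (hcol (A j) (hAU j) (hA1 j) (ζ j) (hζ j) ν₀ hν₀U)
    have h2 := abs_le.1 (hν₀.1 j)
    have h3 : e * n ≤ e * R := by gcongr
    rw [abs_le]
    constructor <;> linarith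
  have hopt := hν.2 _ hfeas
  have hconc := hν₀.strong_concavity hlam (w := s • w)
    (fun j => inner_smul_inv_le_one hm0 ((hAw j).trans hκ1))
  have hcolν := abs_le.1 (hcol y hyU hy1 x hx ν₀ hν₀U)
  have hcolw := abs_le.1 (hcol y hyU hy1 x hx w hw)
  have hxν : ⟪‖Ψ y‖⁻¹ • Ψ y + x, ν⟫ = ⟪‖Ψ y‖⁻¹ • Ψ y + x, Ψ w⟫ + ⟪x, q⟫ := by
    rw [hwq, inner_add_right, inner_add_left _ _ q, hq' _ _ hyU]; ring
  have hνsq : ‖ν‖ ^ 2 = ‖Ψ w‖ ^ 2 + t ^ 2 := by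
    rw [hwq, norm_add_sq_real, hq w hw]; ring
  rw [real_inner_self_eq_norm_sq, real_inner_self_eq_norm_sq, hxν, hνsq, inner_smul_right,
    norm_smul, Real.norm_of_nonneg hs0.le, mul_pow] at hopt
  rw [inner_smul_right, norm_smul, Real.norm_of_nonneg hs0.le, mul_pow, ← ha, ← hn] at hconc
  have hxq : ⟪x, q⟫ ≤ h * t := (real_inner_le_norm _ _).trans (by gcongr)
  have hyν : ⟪y, ν₀⟫ ≤ n := by simpa [hy1] using real_inner_le_norm y ν₀
  have hyw : ⟪y, w⟫ ≤ a := by simpa [hy1] using real_inner_le_norm y w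
  set X := ‖s • w - ν₀‖ with hX
  set ξ := ⟪‖Ψ y‖⁻¹ • Ψ y + x, Ψ ν₀⟫ with hξ
  set ω := ⟪‖Ψ y‖⁻¹ • Ψ y + x, Ψ w⟫ with hω
  have hen : e * n ≤ e * R := by gcongr
  have hfirst : ⟪y, ν₀⟫ - s * ξ ≤ 21 * (e * R ^ 2) := by
    have h1 : (1 - s) * ⟪y, ν₀⟫ ≤ κ * R :=
      (mul_le_mul_of_nonneg_left (hyν.trans hn0) (by linarith)).trans
        (mul_le_mul_of_nonneg_right hsκ (by linarith))
    have h2 : s * (⟪y, ν₀⟫ - ξ) ≤ 6 * (e * R) := by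
      calc s * (⟪y, ν₀⟫ - ξ) ≤ s * (6 * (e * R)) := by gcongr; linarith [hcolν.1]
        _ ≤ 1 * (6 * (e * R)) := by gcongr
        _ = _ := one_mul _
    have h3 : κ * R = 15 * (e * R ^ 2) := by rw [hκ]; ring
    linarith
  have hsecond : ω + ⟪x, q⟫ - s * ⟪y, w⟫ ≤ 45 * (e * R ^ 2) := by
    have h1 : (1 - s) * ⟪y, w⟫ ≤ κ * (2 * R) :=
      (mul_le_mul_of_nonneg_left (hyw.trans haR) (by linarith)).trans
        (mul_le_mul_of_nonneg_right hsκ (by linarith))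
    have h3 : κ * (2 * R) = 30 * (e * R ^ 2) := by rw [hκ]; ring
    linarith [hcolw.2]
  have hthird : s ^ 2 * ‖Ψ ν₀‖ ^ 2 - n ^ 2 + s ^ 2 * a ^ 2 - ‖Ψ w‖ ^ 2 ≤ 5 * (e * R ^ 2) := by
    have h1 := (norm_map_sq_bounds (hΨ ν₀ hν₀U ν₀ hν₀U)).2
    have h2 := (norm_map_sq_bounds (hΨ w hw w hw)).1
    have hs2 : s ^ 2 ≤ 1 := pow_le_one₀ hs0.le hs1
    have h3 : s ^ 2 * ‖Ψ ν₀‖ ^ 2 ≤ ‖Ψ ν₀‖ ^ 2 := mul_le_of_le_one_left (by positivity) hs2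
    have h4 : s ^ 2 * a ^ 2 ≤ a ^ 2 := mul_le_of_le_one_left (by positivity) hs2
    have h5 : e * n ^ 2 ≤ e * R ^ 2 := by gcongr
    have h6 : e * a ^ 2 ≤ e * (2 * R) ^ 2 := by gcongr
    rw [← hn] at h1
    rw [← ha] at h2
    linarith
  -- Adding `hopt` and `hconc` leaves `lam / 2 * X ^ 2` bounded by the three discrepancies: `2 * (21
  -- + 45 + 5 / 2) = 137`.
  have hX2 : lam * X ^ 2 ≤ 140 * (e * R ^ 2) := by
    have h1 : lam / 2 * (s ^ 2 * ‖Ψ ν₀‖ ^ 2 - n ^ 2 + s ^ 2 * a ^ 2 - ‖Ψ w‖ ^ 2)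
        ≤ 1 / 2 * (5 * (e * R ^ 2)) :=
      (mul_le_mul_of_nonneg_left hthird (by positivity)).trans (by gcongr)
    have h2 : 0 ≤ lam / 2 * t ^ 2 := by positivity
    linarith
  -- The universal constant is fixed here: `140 * 25 ^ 2 = 87500 < 100000`.
  have hρX : ρ * X ≤ D / 25 := by
    refine (abs_le_of_sq_le_sq' ?_ (by positivity)).2
    refine le_of_mul_le_mul_left ?_ hlam
    calc lam * (ρ * X) ^ 2 = ρ ^ 2 * (lam * X ^ 2) := by ring
      _ ≤ ρ ^ 2 * (140 * (e * R ^ 2)) := by gcongr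
      _ = 140 * e * (ρ * R) ^ 2 := by ring
      _ ≤ lam * (D / 25) ^ 2 := by rw [hRρ]; linarith
  refine ⟨?_, hq1, ?_⟩
  · rw [div_eq_mul_inv]; linarith
  · have h1 : ‖w - s • w‖ ≤ κ * a := by
      have : w - s • w = (1 - s) • w := by rw [sub_smul, one_smul]
      rw [this, norm_smul, Real.norm_of_nonneg (by linarith)]
      gcongr
    have h2 : ‖w - ν₀‖ ≤ κ * a + X := by
      calc ‖w - ν₀‖ = ‖(w - s • w) + (s • w - ν₀)‖ := by congr 1; abel
        _ ≤ _ := (norm_add_le _ _).trans (add_le_add h1 le_rfl)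
    have h3 : κ * (ρ * a) ≤ κ * 2 := by gcongr; linarith
    calc ρ * ‖w - ν₀‖ ≤ ρ * (κ * a + X) := by gcongr
      _ = κ * (ρ * a) + ρ * X := by ring
      _ ≤ D / 20 := by linarith

end Perturbation

/-! ### Strict feasibility off the cluster, and nontriviality of the solutions. -/

section Detection

variable {d p N k : ℕ}

/-- The defining bound is not homogeneous. Applying it to normalized vectors, which stay in the
union of the subspaces, replaces the mean of squares by the product of norms. -/
theorem WellBehaved.abs_inner_sub_le {Ψ : Vec d →ₗ[ℝ] Vec p} {U : Fin k → Submodule ℝ (Vec d)}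
    {X Z : Fin N → Vec d} {ε : ℝ} (h : WellBehaved Ψ U X Z ε) {l l' : Fin k} {x y : Vec d}
    (hx : x ∈ (U l : Set (Vec d)) ∪ U l') (hy : y ∈ (U l : Set (Vec d)) ∪ U l') :
    |⟪x, y⟫ - ⟪Ψ x, Ψ y⟫| ≤ ε * ‖x‖ * ‖y‖ := by
  rcases eq_or_ne x 0 with rfl | hx0
  · simp
  rcases eq_or_ne y 0 with rfl | hy0
  · simp
  have hxp := norm_pos_iff.2 hx0
  have hyp := norm_pos_iff.2 hy0
  have hmem : ∀ (s : ℝ) {v : Vec d}, v ∈ (U l : Set (Vec d)) ∪ U l' →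
      s • v ∈ (U l : Set (Vec d)) ∪ U l' := fun s v hv =>
    hv.imp (fun h => (U l).smul_mem s h) (fun h => (U l').smul_mem s h)
  have h1 := h.inner_approx l l' _ (hmem ‖x‖⁻¹ hx) _ (hmem ‖y‖⁻¹ hy)
  rw [norm_smul, norm_smul, norm_inv, norm_inv, norm_norm, norm_norm, inv_mul_cancel₀ hxp.ne',
    inv_mul_cancel₀ hyp.ne', map_smul, map_smul] at h1
  simp only [inner_smul_left, inner_smul_right, RCLike.conj_to_real] at h1
  have h2 : ⟪x, y⟫ - ⟪Ψ x, Ψ y⟫ = ‖x‖ * ‖y‖ * (‖x‖⁻¹ * (‖y‖⁻¹ * ⟪x, y⟫)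
      - ‖x‖⁻¹ * (‖y‖⁻¹ * ⟪Ψ x, Ψ y⟫)) := by
    field_simp
  rw [h2, abs_mul, abs_of_pos (mul_pos hxp hyp)]
  calc _ ≤ ‖x‖ * ‖y‖ * (ε * ((1 ^ 2 + 1 ^ 2) / 2)) := by
        gcongr
        exact le_of_eq_of_le (congrArg abs (by ring)) h1
    _ = _ := by ring

/-- Strict dual feasibility off the cluster, from the stability of the dual direction. -/
theorem abs_inner_lt_one_of_perturbation {Ψ : Vec d →ₗ[ℝ] Vec p} {y z w w₁ ν₀ : Vec d}
    {ζ q : Vec p} {e h ρ μ lam D : ℝ} (hy1 : ‖y‖ = 1) (hΨy : |1 - ‖Ψ y‖ ^ 2| ≤ e)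
    (hΨw : ‖Ψ w‖ ≤ (1 + e) * ‖w‖) (hyw : |⟪y, w⟫ - ⟪Ψ y, Ψ w⟫| ≤ e * ‖w‖)
    (hz : ‖z‖ ≤ e) (hζ : ‖ζ‖ ≤ h) (hhe : h ≤ 2 * e) (hlam : 0 < lam) (hhD : h ≤ lam * D / 20)
    (hρ0 : 0 < ρ) (hρ1 : ρ ≤ 1) (heD : e ≤ 1 / 100000 * (D * ρ)) (hD0 : 0 < D)
    (hμ0 : 0 ≤ μ) (hμD : μ + D ≤ ρ) (hμ : |⟪‖w₁‖⁻¹ • w₁, y + z⟫| ≤ μ)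
    (hw : ρ * ‖w‖ ≤ 1 + 15 * (e / ρ)) (hw₁ : ρ * ‖w₁‖ ≤ 1 + 15 * (e / ρ))
    (hq : lam * ‖q‖ ≤ h * (1 + 2 * ‖w‖)) (hwν : ρ * ‖w - ν₀‖ ≤ D / 20)
    (hw₁ν : ρ * ‖w₁ - ν₀‖ ≤ D / 20) :
    |⟪‖Ψ y‖⁻¹ • Ψ y + ζ, Ψ w + q⟫| < 1 := by
  have he0 : 0 ≤ e := (abs_nonneg _).trans hΨy
  have hE : e / ρ ≤ 1 / 100000 * D := by
    rw [div_le_iff₀ hρ0]; linarith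
  have hE0 : 0 ≤ e / ρ := by positivity
  have hee : e ≤ e / ρ := le_div_self he0 hρ0 hρ1
  have hcol := abs_inner_normalized_add_sub_le (by linarith) hΨy hΨw hyw (hζ.trans hhe)
  have hwd : ρ * ‖w - w₁‖ ≤ D / 10 := by
    have h1 : ‖w - w₁‖ ≤ ‖w - ν₀‖ + ‖w₁ - ν₀‖ := by
      rw [norm_sub_rev w₁ ν₀]
      exact norm_sub_le_norm_sub_add_norm_sub _ _ _
    nlinarith
  have hyw₁ : |⟪y, w₁⟫| ≤ (μ + e) * ‖w₁‖ := by
    have h1 : |⟪w₁, y + z⟫| ≤ μ * ‖w₁‖ := by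
      -- If the projection vanishes, its normalization is 0 and `hμ` carries no information, but the
      -- bound is trivial.
      rcases eq_or_ne w₁ 0 with rfl | h0
      · simp
      · rw [inner_smul_left, RCLike.conj_to_real, abs_mul, abs_inv, abs_norm,
          inv_mul_le_iff₀ (norm_pos_iff.2 h0)] at hμ
        linarith
    have h2 : |⟪w₁, z⟫| ≤ ‖w₁‖ * e := (abs_real_inner_le_norm _ _).trans (by gcongr)
    have h3 : ⟪y, w₁⟫ = ⟪w₁, y + z⟫ - ⟪w₁, z⟫ := by
      rw [inner_add_right, real_inner_comm]; ring
    rw [h3]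
    refine (abs_sub _ _).trans ?_
    linarith
  have hyww : |⟪y, w⟫| ≤ ‖w - w₁‖ + (μ + e) * ‖w₁‖ := by
    have h1 : ⟪y, w⟫ = ⟪y, w - w₁⟫ + ⟪y, w₁⟫ := by rw [← inner_add_right, sub_add_cancel]
    rw [h1]
    refine (abs_add_le _ _).trans (add_le_add ?_ hyw₁)
    simpa [hy1] using abs_real_inner_le_norm y (w - w₁)
  have hcolq : |⟪‖Ψ y‖⁻¹ • Ψ y + ζ, q⟫| ≤ (1 + h) * ‖q‖ := by
    refine (abs_real_inner_le_norm _ _).trans ?_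
    gcongr
    refine (norm_add_le _ _).trans (add_le_add ?_ hζ)
    rw [norm_smul, norm_inv, norm_norm]
    exact inv_mul_le_one
  -- The lower bound on `lam` enters here, through `hhD`: it makes the noise over `lam` a small
  -- multiple of the gap.
  have hq1 : ρ * ‖q‖ ≤ D / 4 := by
    have h1 : ‖q‖ ≤ D / 20 * (1 + 2 * ‖w‖) := by
      refine le_of_mul_le_mul_left (hq.trans ?_) hlam
      calc h * (1 + 2 * ‖w‖) ≤ lam * D / 20 * (1 + 2 * ‖w‖) := by gcongr
        _ = _ := by ring
    calc ρ * ‖q‖ ≤ ρ * (D / 20 * (1 + 2 * ‖w‖)) := by gcongr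
      _ = D / 20 * (ρ + 2 * (ρ * ‖w‖)) := by ring
      _ ≤ D / 20 * 5 := by gcongr; linarith
      _ = D / 4 := by ring
  have hsum : |⟪‖Ψ y‖⁻¹ • Ψ y + ζ, Ψ w + q⟫|
      ≤ ‖w - w₁‖ + (μ + e) * ‖w₁‖ + 6 * e * ‖w‖ + (1 + h) * ‖q‖ := by
    rw [inner_add_right]
    refine (abs_add_le _ _).trans (add_le_add ?_ hcolq)
    have := abs_sub_abs_le_abs_sub (⟪‖Ψ y‖⁻¹ • Ψ y + ζ, Ψ w⟫) ⟪y, w⟫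
    linarith
  refine lt_of_mul_lt_mul_left ?_ hρ0.le
  rw [mul_one]
  calc ρ * |⟪‖Ψ y‖⁻¹ • Ψ y + ζ, Ψ w + q⟫|
      ≤ ρ * (‖w - w₁‖ + (μ + e) * ‖w₁‖ + 6 * e * ‖w‖ + (1 + h) * ‖q‖) := by gcongr
    _ = ρ * ‖w - w₁‖ + (μ + e) * (ρ * ‖w₁‖) + 6 * e * (ρ * ‖w‖) + (1 + h) * (ρ * ‖q‖) := by ring
    _ ≤ D / 10 + (μ + e) * (1 + 15 * (e / ρ)) + 6 * e * 2 + 11 / 10 * (D / 4) := by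
        gcongr <;> linarith
    _ < ρ := by nlinarith

/-- Some column of the cluster has a large inner product with the given one after compression. -/
theorem inradius_mul_le_of_abs_inner_le {ι : Type*} {U : Submodule ℝ (Vec d)}
    {Ψ : Vec d →ₗ[ℝ] Vec p} {y : Vec d} {A : ι → Vec d} {x : Vec p} {ζ : ι → Vec p}
    {ε h ρ lam : ℝ} (hε0 : 0 ≤ ε) (hε1 : ε < 1) (hyU : y ∈ U) (hy1 : ‖y‖ = 1)
    (hρ : ∀ u ∈ U, ∀ M, 0 ≤ M → (∀ j, |⟪A j, u⟫| ≤ M) → ρ * ‖u‖ ≤ M) (hρ0 : 0 ≤ ρ)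
    (hAU : ∀ j, A j ∈ U) (hlam : 0 ≤ lam) (hy : 1 - ε ≤ ‖Ψ y‖ ^ 2)
    (hA : ∀ j, 0 < ‖Ψ (A j)‖ ∧ ‖Ψ (A j)‖ ^ 2 ≤ 1 + ε) (hx : ‖x‖ ≤ h) (hζ : ∀ j, ‖ζ j‖ ≤ h)
    (hle : ∀ j, |⟪‖Ψ (A j)‖⁻¹ • Ψ (A j) + ζ j, ‖Ψ y‖⁻¹ • Ψ y + x⟫| ≤ lam) :
    ρ * (1 - ε) ≤ lam + 2 * h + h ^ 2 := by
  have hh : 0 ≤ h := (norm_nonneg _).trans hx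
  -- On `U`, pairing with `w` is pairing with `Ψ y` after compression, so the inradius in `U`
  -- applies to compressed correlations; testing with `y` bounds `‖w‖` from below.
  set w := U.starProjection (LinearMap.adjoint Ψ (Ψ y)) with hw
  have hwin : ∀ u ∈ U, ⟪u, w⟫ = ⟪Ψ u, Ψ y⟫ := by
    intro u hu
    rw [hw, ← U.inner_starProjection_left_eq_right, U.starProjection_eq_self_iff.2 hu,
      LinearMap.adjoint_inner_right]
  set α := ‖Ψ y‖ with hα
  have hα0 : 0 < α := by
    refine (norm_nonneg _).lt_of_ne fun h0 => ?_
    rw [hα, ← h0] at hy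
    norm_num at hy
    linarith
  have hαw : α ^ 2 ≤ ‖w‖ := by
    have h1 := hwin y hyU
    rw [real_inner_self_eq_norm_sq] at h1
    rw [← h1]
    simpa [hy1] using real_inner_le_norm y w
  set β := √(1 + ε) with hβ
  have hβ2 : β ^ 2 = 1 + ε := Real.sq_sqrt (by linarith)
  have hβ0 : 0 < β := Real.sqrt_pos.2 (by linarith)
  have hM : ∀ j, |⟪A j, w⟫| ≤ β * α * (lam + 2 * h + h ^ 2) := by
    intro j
    obtain ⟨hj0, hj⟩ := hA j
    rw [hwin _ (hAU j)]
    set u := ‖Ψ (A j)‖⁻¹ • Ψ (A j) with hu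
    set v := α⁻¹ • Ψ y with hv
    have hu1 : ‖u‖ = 1 := by
      rw [hu, norm_smul, norm_inv, norm_norm, inv_mul_cancel₀ hj0.ne']
    have hv1 : ‖v‖ = 1 := by
      rw [hv, norm_smul, norm_inv, hα, norm_norm, inv_mul_cancel₀ hα0.ne']
    have h1 : ⟪Ψ (A j), Ψ y⟫ = ‖Ψ (A j)‖ * α * ⟪u, v⟫ := by
      rw [hu, hv, inner_smul_left, inner_smul_right]
      simp only [RCLike.conj_to_real]
      field_simp
    have h2 : ⟪u, v⟫ = ⟪u + ζ j, v + x⟫ - ⟪u, x⟫ - ⟪ζ j, v⟫ - ⟪ζ j, x⟫ := by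
      simp only [inner_add_left, inner_add_right]; ring
    have h3 : |⟪u, x⟫| ≤ h := by
      have := abs_real_inner_le_norm u x
      rw [hu1] at this; linarith
    have h4 : |⟪ζ j, v⟫| ≤ h := by
      have := abs_real_inner_le_norm (ζ j) v
      rw [hv1] at this; linarith [hζ j]
    have h5 : |⟪ζ j, x⟫| ≤ h ^ 2 := by
      rw [sq]
      exact (abs_real_inner_le_norm _ _).trans (mul_le_mul (hζ j) hx (norm_nonneg _) hh)
    have h6 : |⟪u, v⟫| ≤ lam + 2 * h + h ^ 2 := by
      have h7 := abs_le.1 (hle j)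
      rw [abs_le] at h3 h4 h5 ⊢
      rw [h2]
      constructor <;> linarith
    have hjβ : ‖Ψ (A j)‖ ≤ β := Real.le_sqrt_of_sq_le hj
    rw [h1, abs_mul, abs_of_pos (mul_pos hj0 hα0)]
    gcongr
  have h1 := hρ w (U.starProjection_apply_mem _) _ (by positivity) hM
  have h2 : ρ * α ≤ β * (lam + 2 * h + h ^ 2) := by
    refine le_of_mul_le_mul_right ?_ hα0
    calc ρ * α * α = ρ * α ^ 2 := by ring
      _ ≤ ρ * ‖w‖ := by gcongr
      _ ≤ _ := h1
      _ = _ := by ring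
  -- After squaring this is `(1 - ε) ^ 2 * (1 + ε) ≤ 1 - ε`; it produces the exact factor `1 - ε`.
  have h3 : (1 - ε) * β ≤ α := by
    refine (abs_le_of_sq_le_sq' ?_ hα0.le).2
    rw [mul_pow, hβ2]
    nlinarith [mul_nonneg (sq_nonneg ε) (by linarith : 0 ≤ 1 - ε)]
  refine le_of_mul_le_mul_left ?_ hβ0
  calc β * (ρ * (1 - ε)) = ρ * ((1 - ε) * β) := by ring
    _ ≤ ρ * α := by gcongr
    _ ≤ _ := h2

/-- Lets the perturbation bound for compressed data apply to the uncompressed noisy data as well. -/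
theorem compressed_id {Y : Fin N → Vec d} (Z : Fin N → Vec d) (hY : ∀ i, ‖Y i‖ = 1) :
    compressed LinearMap.id Y Z = Y + Z := by
  funext i
  simp [compressed, hY i]

theorem abs_projectedDual_inner_le_incoherence (U : Fin k → Submodule ℝ (Vec d))
    (label : Fin N → Fin k) (lam : ℝ) (X : Fin N → Vec d) (i j : Fin N)
    (hij : label j ≠ label i) :
    |⟪projectedDual U label lam X i, X j⟫| ≤ incoherence U label lam X (label i) := by
  refine le_ciSup_of_le (Set.finite_range _).bddAbove ⟨i, rfl⟩ ?_
  exact le_ciSup (f := fun j : {j : Fin N // label j ≠ label i} =>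
    |⟪projectedDual U label lam X i, X j⟫|) (Set.finite_range _).bddAbove ⟨j, hij⟩

theorem incoherence_nonneg (U : Fin k → Submodule ℝ (Vec d))
    (label : Fin N → Fin k) (lam : ℝ) (X : Fin N → Vec d) (l : Fin k) :
    0 ≤ incoherence U label lam X l :=
  Real.iSup_nonneg fun _ => Real.iSup_nonneg fun _ => abs_nonneg _

theorem clusterInradius_mul_norm_le (U : Fin k → Submodule ℝ (Vec d))
    (label : Fin N → Fin k) (Y : Fin N → Vec d) (i : Fin N) {w : Vec d} (hw : w ∈ U (label i))
    {M : ℝ} (hM : 0 ≤ M) (h : ∀ j, |⟪clusterWithout Y label i j, w⟫| ≤ M) :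
    clusterInradius U label Y (label i) * ‖w‖ ≤ M := by
  refine le_trans ?_ (inradius_mul_norm_le hw hM h)
  gcongr
  exact ciInf_le (f := fun i' : {i' : Fin N // label i' = label i} =>
    inradius (U (label i)) (symmHull (clusterWithout Y label i')))
    (Set.finite_range _).bddBelow ⟨i, rfl⟩

end Detection

end CompressedSSC

/-! ### The detection theorem. -/

open CompressedSSC in
theorem mainTheorem2 :
    ∃ c : ℝ, 0 < c ∧
      ∀ (d p N k : ℕ) (U : Fin k → Submodule ℝ (CompressedSSC.Vec d)) (label : Fin N → Fin k)
        (Y Z : Fin N → CompressedSSC.Vec d)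
        (Ψ : CompressedSSC.Vec d →ₗ[ℝ] CompressedSSC.Vec p) (ε η lam : ℝ),
        (∀ i, Y i ∈ U (label i)) →
        (∀ i, ‖Y i‖ = 1) →
        (∀ i, ‖Z i‖ ≤ η) →
        (∀ l, CompressedSSC.incoherence U label lam (Y + Z) l
          < CompressedSSC.clusterInradius U label Y l) →
        CompressedSSC.WellBehaved Ψ U (Y + Z) Z ε →
        24 * η / CompressedSSC.gap U label lam Y Z < lam →
        lam < CompressedSSC.minInradius U label Y * (1 - ε) - 6 * η →
        max ε η ≤ c * (CompressedSSC.gap U label lam Y Z ^ 2 * lam ^ (3 / 2 : ℝ)) →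
        CompressedSSC.LassoSSCDetects (CompressedSSC.compressed Ψ Y Z) label lam := by
  refine ⟨1 / 100000, by norm_num, ?_⟩
  intro d p N k U label Y Z Ψ ε η lam hYU hY1 hZ hμρ hΨ hlamη hlamρ hmax
  suffices hmain : ∀ i : Fin N, 0 < lam ∧ ∀ c, IsLassoSolution (compressed Ψ Y Z) lam i c →
      c ≠ 0 ∧ ∀ j, c j ≠ 0 → label i = label j by
    refine ⟨?_, fun C hC i => (hmain i).2 _ (hC i)⟩
    have hex : ∀ i, ∃ c, IsLassoSolution (compressed Ψ Y Z) lam i c := by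
      intro i
      obtain ⟨c, hc, hcmin⟩ :=
        exists_lassoObjective_minimizer (compressed Ψ Y Z) (hmain i).1 i {j | j ≠ i}
      refine ⟨c, hc i (by simp), fun c' hc' => hcmin c' fun j hj => ?_⟩
      have hji : j = i := by simpa using hj
      rw [hji, hc']
    choose C hC using hex
    exact ⟨C, hC⟩
  intro i
  have hη0 : 0 ≤ η := (norm_nonneg _).trans (hZ i)
  set l := label i with hl
  have : Nonempty (Fin k) := ⟨l⟩
  set ρ := clusterInradius U label Y l with hρdef
  set μ := incoherence U label lam (Y + Z) l with hμdef
  set D := gap U label lam Y Z with hD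
  have hD0 : 0 < D := by
    obtain ⟨l', hl'⟩ := exists_eq_ciInf_of_finite
      (f := fun l => clusterInradius U label Y l - incoherence U label lam (Y + Z) l)
    rw [hD, gap, ← hl']
    exact sub_pos.2 (hμρ l')
  have hμD : μ + D ≤ ρ := by
    have : D ≤ ρ - μ := ciInf_le
      (f := fun l => clusterInradius U label Y l - incoherence U label lam (Y + Z) l)
      (Set.finite_range _).bddBelow l
    linarith
  have hμ0 : 0 ≤ μ := incoherence_nonneg ..
  have hρ0 : 0 < ρ := by linarith
  have hρ : ∀ u ∈ U l, ∀ M, 0 ≤ M → (∀ j, |⟪clusterWithout Y label i j, u⟫| ≤ M) →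
      ρ * ‖u‖ ≤ M := fun u hu M hM h => clusterInradius_mul_norm_le U label Y i hu hM h
  have hρ1 : ρ ≤ 1 := by
    have := hρ (Y i) (hYU i) 1 zero_le_one fun j => by
      simpa [clusterWithout, hY1] using abs_real_inner_le_norm (Y j) (Y i)
    simpa [hY1] using this
  have hunit : ∀ j, |1 - ‖Ψ (Y j)‖ ^ 2| ≤ ε := fun j => by
    simpa [hY1] using hΨ.abs_inner_sub_le (l := label j) (l' := label j) (x := Y j) (y := Y j)
      (Or.inl (hYU j)) (Or.inl (hYU j))
  have hε0 : 0 ≤ ε := (abs_nonneg _).trans (hunit i)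
  have hlam : 0 < lam := lt_of_le_of_lt (by positivity) hlamη
  have hmin0 : 0 ≤ minInradius U label Y :=
    Real.iInf_nonneg fun l' => (incoherence_nonneg ..).trans (hμρ l').le
  have hminρ : minInradius U label Y ≤ ρ :=
    ciInf_le (f := fun l => clusterInradius U label Y l) (Set.finite_range _).bddBelow l
  have hlam1 : lam ≤ 1 := by nlinarith
  set e := max ε η with he
  have hεe : ε ≤ e := le_max_left _ _
  have hηe : η ≤ e := le_max_right _ _
  have he0 : 0 ≤ e := hε0.trans hεe
  -- Since `lam ≤ 1`, the power `3 / 2` may be lowered to 1; the argument needs no more than this.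
  have heD : e ≤ 1 / 100000 * (D ^ 2 * lam) := by
    refine hmax.trans ?_
    gcongr
    simpa using Real.rpow_le_rpow_of_exponent_ge hlam hlam1 (by norm_num : (1 : ℝ) ≤ 3 / 2)
  have hDρ : D ≤ ρ := by linarith
  have heD' : e ≤ 1 / 100000 * (D * ρ) := by
    have h1 : D ^ 2 * lam ≤ D * ρ := by
      calc D ^ 2 * lam ≤ D ^ 2 * 1 := by gcongr
        _ = D * D := by ring
        _ ≤ D * ρ := by gcongr
    linarith
  have he1 : e ≤ 1 / 100000 := heD'.trans (by nlinarith)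
  -- A common bound for the noise before and after compression, as `1 + ε ≤ (101 / 100) ^ 2`. The
  -- factor 24 in `hlamη` covers `20 * 101 / 100`.
  set h := 101 / 100 * η with hh
  have hηh : η ≤ h := by linarith
  have hhe : h ≤ 2 * e := by linarith
  have hhD : h ≤ lam * D / 20 := by
    rw [div_lt_iff₀ hD0] at hlamη
    linarith
  have hΨZ : ∀ j, ‖Ψ (Z j)‖ ≤ h := by
    intro j
    refine (abs_le_of_sq_le_sq' ?_ (by positivity)).2
    calc ‖Ψ (Z j)‖ ^ 2 ≤ (1 + ε) * ‖Z j‖ ^ 2 := (hΨ.norm_noise j).2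
      _ ≤ (101 / 100) ^ 2 * η ^ 2 := by
        gcongr
        · linarith
        · exact hZ j
      _ = h ^ 2 := by rw [hh]; ring
  have hAU : ∀ j, clusterWithout Y label i j ∈ U l := fun j => by
    have := hYU j
    rwa [j.2.1] at this
  have hA1 : ∀ j, ‖clusterWithout Y label i j‖ = 1 := fun j => hY1 j
  have hΨU : ∀ u ∈ U l, ∀ v ∈ U l, |⟪u, v⟫ - ⟪Ψ u, Ψ v⟫| ≤ e * ‖u‖ * ‖v‖ := fun u hu v hv =>
    (hΨ.abs_inner_sub_le (l := l) (l' := l) (Or.inl hu) (Or.inl hv)).trans (by gcongr)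
  refine ⟨hlam, fun c hc => ⟨?_, ?_⟩⟩
  · rintro rfl
    have hle : ∀ j : {j : Fin N // label j = label i ∧ j ≠ i},
        |⟪‖Ψ (clusterWithout Y label i j)‖⁻¹ • Ψ (clusterWithout Y label i j) + Ψ (Z j),
          ‖Ψ (Y i)‖⁻¹ • Ψ (Y i) + Ψ (Z i)⟫| ≤ lam := by
      intro j
      have h1 := (lasso_kkt hlam (S := {j | j ≠ i}) (c := 0) (fun _ _ => rfl)
        (fun c' hc' => hc.2 c' (hc' i (by simp))) (j := j) j.2.2).1
      simpa [compressed, clusterWithout] using h1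
    have h1 := inradius_mul_le_of_abs_inner_le hε0 (by linarith) (hYU i) (hY1 i) hρ hρ0.le hAU
      hlam.le (by linarith [(abs_le.1 (hunit i)).2])
      (fun j => ⟨by
        refine norm_pos_iff.2 fun h0 => ?_
        have := hunit j
        rw [show Ψ (Y j) = 0 from h0] at this
        norm_num at this
        linarith, by
        have := (abs_le.1 (hunit j)).1
        change ‖Ψ (Y j)‖ ^ 2 ≤ 1 + ε
        linarith⟩) (hΨZ i) (fun j => hΨZ j) hle
    have h2 : minInradius U label Y * (1 - ε) ≤ ρ * (1 - ε) :=
      mul_le_mul_of_nonneg_right hminρ (by linarith)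
    -- As `η` is tiny, `2 * h + h ^ 2 ≤ 6 * η`, contradicting the upper bound on `lam`.
    nlinarith
  · obtain ⟨ν, hν, hcert⟩ := exists_dualDirection_certificate (compressed Ψ Y Z) label hlam i
    refine hcert (fun j hj => ?_) c hc
    have hν₀ := dualDirection_spec hlam (Y i) (clusterWithout Y label i)
    set V := (U l).map Ψ with hV
    obtain ⟨w, hwU, hw⟩ : ∃ w ∈ U l, Ψ w = V.starProjection ν :=
      Submodule.mem_map.1 (V.starProjection_apply_mem ν)
    have hwq : ν = Ψ w + (ν - V.starProjection ν) := by rw [hw]; abel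
    obtain ⟨hw1, hq1, hw2⟩ := dualDirection_perturbation (hYU i) hAU (hY1 i) hA1 hΨU hρ hρ0 hρ1
      hlam hlam1 he0 heD hD0 hDρ (hΨZ i) (fun j => hΨZ j) hhe hhD hν₀ hν hwU hwq
      (fun u hu => Submodule.inner_right_of_mem_orthogonal (Submodule.mem_map_of_mem hu)
        (V.sub_starProjection_mem_orthogonal ν))
    have hν₁ := dualDirection_spec hlam ((Y + Z) i) (clusterWithout (Y + Z) label i)
    set ν₁ := dualDirection lam ((Y + Z) i) (clusterWithout (Y + Z) label i) with hν₁def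
    set w₁ := (U l).starProjection ν₁ with hw₁
    -- Second use of the stability bound, now with the identity as compression; both directions end
    -- up near the same `ν₀`.
    rw [← compressed_id Z hY1] at hν₁
    obtain ⟨hw₁1, -, hw₁2⟩ := dualDirection_perturbation (Ψ := LinearMap.id) (w := w₁)
      (q := ν₁ - w₁) (hYU i) hAU (hY1 i) hA1
      (fun u _ v _ => by simp only [LinearMap.id_apply, sub_self, abs_zero]; positivity) hρ hρ0 hρ1
      hlam hlam1 he0 heD hD0 hDρ ((hZ i).trans hηh) (fun j => (hZ j).trans hηh) hhe hhD hν₀ hν₁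
      ((U l).starProjection_apply_mem ν₁) (by simp)
      (fun u hu => Submodule.inner_right_of_mem_orthogonal hu
        ((U l).sub_starProjection_mem_orthogonal ν₁))
    rw [hwq]
    exact abs_inner_lt_one_of_perturbation (hY1 j) ((hunit j).trans hεe)
      (norm_map_le he0 (hΨU w hwU w hwU))
      (by
        have h1 := hΨ.abs_inner_sub_le (l := label j) (l' := l) (x := Y j) (y := w)
          (Or.inl (hYU j)) (Or.inr hwU)
        rw [hY1, mul_one] at h1
        exact h1.trans (by gcongr))
      ((hZ j).trans hηe) (hΨZ j) hhe hlam hhD hρ0 hρ1 heD' hD0 hμ0 hμD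
      (abs_projectedDual_inner_le_incoherence U label lam (Y + Z) i j hj) hw1 hw₁1 hq1 hw2 hw₁2
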